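/- Let $b\in\mathbb R$, $\lambda_1>0$, $\lambda_2\le 0$, $\lambda_3>0$ and $0<p\le\frac43$. Let $$X=\Big\{u\in H^1(\mathbb R^3;\mathbb C):\ \int_{\mathbb R^3}(x_1^2+x_2^2)|u|^2\,dx<\infty\Big\},$$ and for $u\in X$ put $$E_b(u)=\tfrac12\|\nabla u\|_{L^2}^2+\tfrac{b^2}{2}\int_{\mathbb R^3}(x_1^2+x_2^2)|u|^2dx+\tfrac{\lambda_1}{2}\int_{\mathbb R^3}\frac{|u|^2}{|x|}dx+\tfrac{\lambda_2}{4}\int_{\mathbb R^3}(|x|^{-1}*|u|^2)|u|^2dx-\tfrac{\lambda_3}{p+2}\|u\|_{L^{p+2}}^{p+2}.$$ For $c>0$ let $\bar S(c)=\{u\in X:\|u\|_{L^2}^2=c\}$, $m(c)=\inf_{u\in\bar S(c)}E_b(u)\in[-\infty,\infty)$ and $\mathcal M_c=\{u\in\bar S(c):E_b(u)=m(c)\}$. Let $R$ be a ground state of $$-\Delta w+w-|w|^{4/3}w=0\quad\text{in }\mathbb R^3,$$ that is, a weak solution $R\in H^1(\mathbb R^3;\mathbb C)\setminus\{0\}$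 that minimizes the action $\tfrac12\|\nabla w\|_{L^2}^2+\tfrac12\|w\|_{L^2}^2-\tfrac{3}{10}\|w\|_{L^{10/3}}^{10/3}$ among all weak solutions $w\in H^1(\mathbb R^3;\mathbb C)\setminus\{0\}$. If either $0<p<\frac43$ and $c>0$, or $p=\frac43$ and $0<c<\lambda_3^{-3/2}\|R\|_{L^2}^2$, then $\mathcal M_c=\emptyset$; that is, $m(c)$ has no minimizer. -/

import Mathlib

open MeasureTheory
open scoped ContDiff

namespace XFEL

noncomputable section

/-- Three-dimensional Euclidean space. -/
abbrev Space : Type := EuclideanSpace ℝ (Fin 3)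

/-- Real test functions: smooth and compactly supported. -/
def IsTest (φ : Space → ℝ) : Prop :=
  ContDiff ℝ ∞ φ ∧ HasCompactSupport φ

/-- The classical partial derivative of a test function in the `i`-th coordinate direction. -/
def pderiv (i : Fin 3) (φ : Space → ℝ) (x : Space) : ℝ :=
  fderiv ℝ φ x (EuclideanSpace.single i 1)

/-- `g` is a square integrable weak partial derivative of `u` in the `i`-th direction. -/
def HasWeakPartial (i : Fin 3) (u g : Space → ℂ) : Prop :=
  MemLp g 2 volume ∧
    ∀ φ : Space → ℝ, IsTest φ → ∫ x, pderiv i φ x • u x = -∫ x, φ x • g x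

/-- Weak partial derivatives are unique up to null sets. -/
theorem HasWeakPartial.ae_eq {i : Fin 3} {u g h : Space → ℂ}
    (hg : HasWeakPartial i u g) (hh : HasWeakPartial i u h) : g =ᵐ[volume] h := by
  refine ae_eq_of_integral_contDiff_smul_eq (hg.1.locallyIntegrable (by norm_num))
    (hh.1.locallyIntegrable (by norm_num)) fun φ hφ hc => ?_
  exact neg_injective ((hg.2 φ ⟨hφ, hc⟩).symm.trans (hh.2 φ ⟨hφ, hc⟩))

open Classical in
/-- The weak partial derivative of `u` in the `i`-th direction (determined up to null sets),
with the value `0` if there is no square integrable one. -/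
def weakPartial (i : Fin 3) (u : Space → ℂ) : Space → ℂ :=
  if h : ∃ g, HasWeakPartial i u g then h.choose else 0

/-- The complex-valued Sobolev space `H¹(ℝ³)`. -/
def MemH1 (u : Space → ℂ) : Prop :=
  MemLp u 2 volume ∧ ∀ i, ∃ g, HasWeakPartial i u g

theorem MemH1.hasWeakPartial {u : Space → ℂ} (hu : MemH1 u) (i : Fin 3) :
    HasWeakPartial i u (weakPartial i u) := by
  rw [weakPartial, dif_pos (hu.2 i)]
  exact (hu.2 i).choose_spec

/-- The energy space `X`: functions in `H¹` with finite partial harmonic energy. -/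
def MemX (u : Space → ℂ) : Prop :=
  MemH1 u ∧ Integrable (fun x : Space => (x 0 ^ 2 + x 1 ^ 2) * ‖u x‖ ^ 2) volume

/-- The mass `‖u‖²` in `L²`. -/
def mass (u : Space → ℂ) : ℝ := ∫ x, ‖u x‖ ^ 2

/-- `‖∇u‖²` in `L²`. -/
def gradSq (u : Space → ℂ) : ℝ := ∫ x, ∑ i, ‖weakPartial i u x‖ ^ 2

/-- `∫ (x₁² + x₂²) |u|²`. -/
def confinement (u : Space → ℂ) : ℝ := ∫ x : Space, (x 0 ^ 2 + x 1 ^ 2) * ‖u x‖ ^ 2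

/-- `∫ |u|² / |x|`. -/
def coulomb (u : Space → ℂ) : ℝ := ∫ x, ‖u x‖ ^ 2 / ‖x‖

/-- `∫ (|x|⁻¹ ∗ |u|²) |u|²`. -/
def hartree (u : Space → ℂ) : ℝ := ∫ x, (∫ y, ‖x - y‖⁻¹ * ‖u y‖ ^ 2) * ‖u x‖ ^ 2

/-- `‖u‖ ^ q` in `L^q`, that is `∫ |u|^q`. -/
def powerInt (q : ℝ) (u : Space → ℂ) : ℝ := ∫ x, ‖u x‖ ^ q

/-- The energy functional `E_b`. -/
def energy (b l1 l2 l3 p : ℝ) (u : Space → ℂ) : ℝ :=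
  gradSq u / 2 + b ^ 2 / 2 * confinement u + l1 / 2 * coulomb u + l2 / 4 * hartree u
    - l3 / (p + 2) * powerInt (p + 2) u

/-- The constraint set: functions in `X` of mass `c`. -/
def sphere (c : ℝ) : Set (Space → ℂ) := {u | MemX u ∧ mass u = c}

/-- The infimum `m(c)` of the energy over the constraint set, taken in the extended reals, so
that it is `-∞` when the energy is unbounded below. -/
def infEnergy (b l1 l2 l3 p c : ℝ) : EReal :=
  ⨅ u ∈ sphere c, ((energy b l1 l2 l3 p u : ℝ) : EReal)

/-- The set of minimizers of `m(c)`. -/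
def minimizers (b l1 l2 l3 p c : ℝ) : Set (Space → ℂ) :=
  {u | u ∈ sphere c ∧ ((energy b l1 l2 l3 p u : ℝ) : EReal) = infEnergy b l1 l2 l3 p c}

/-- `w` is a nontrivial `H¹` weak solution of `-Δw + w - |w|^(4/3) w = 0` on `ℝ³`. -/
def IsNontrivialSolution (w : Space → ℂ) : Prop :=
  MemH1 w ∧ ¬ (w =ᵐ[volume] 0) ∧
    ∀ φ : Space → ℝ, IsTest φ →
      (∫ x, ∑ i, pderiv i φ x • weakPartial i w x) + (∫ x, φ x • w x)
        - (∫ x, φ x • (‖w x‖ ^ (4 / 3 : ℝ) • w x)) = 0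

/-- The action of the equation `-Δw + w - |w|^(4/3) w = 0`. -/
def action (w : Space → ℂ) : ℝ :=
  gradSq w / 2 + mass w / 2 - powerInt (10 / 3) w / (10 / 3)

/-- A ground state: a nontrivial solution of least action among all nontrivial solutions. -/
def IsGroundState (R : Space → ℂ) : Prop :=
  IsNontrivialSolution R ∧ ∀ w, IsNontrivialSolution w → action R ≤ action w

end

end XFEL

namespace XFEL

open Filter Topology
open scoped ENNReal NNReal Convolution

/-! Translations along the $x_3$-axis preserve the mass and every term of the energy except the
repulsive Coulomb term $\frac{\lambda_1}{2}\int|u|^2/|x|$. That term is strictly positive for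
$u\ne0$ (`MemH1.coulomb_pos`) but tends to $0$ as $u$ is moved to infinity
(`MemH1.tendsto_coulomb_comp_sub_right`). A minimizer could thus be translated to a competitor of
strictly smaller energy, a contradiction.

The analytic work is in the decay of the Coulomb term. The Sobolev embedding $H^1\subset L^6$
(`MemH1.memLp_six`) puts $|u|^2+|u|^6$ in $L^1$, which controls the singularity of $1/|x|$ through
the pointwise bound `sq_div_norm_le`. -/

/-! ### Invariance under translations -/

theorem IsTest.comp_add_right {φ : Space → ℝ} (hφ : IsTest φ) (a : Space) :
    IsTest fun x => φ (x + a) :=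
  ⟨hφ.1.comp (contDiff_id.add contDiff_const),
    hφ.2.comp_homeomorph (Homeomorph.addRight a)⟩

theorem pderiv_comp_add_right (i : Fin 3) (φ : Space → ℝ) (a x : Space) :
    pderiv i (fun x => φ (x + a)) x = pderiv i φ (x + a) := by
  simp only [pderiv, fderiv_comp_add_right]

theorem HasWeakPartial.comp_sub_right {i : Fin 3} {u g : Space → ℂ}
    (h : HasWeakPartial i u g) (a : Space) :
    HasWeakPartial i (fun x => u (x - a)) (fun x => g (x - a)) := by
  refine ⟨h.1.comp_measurePreserving (measurePreserving_sub_right volume a), fun φ hφ => ?_⟩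
  have := h.2 _ (hφ.comp_add_right a)
  simp only [pderiv_comp_add_right] at this
  rw [← integral_add_right_eq_self (fun x => pderiv i φ x • u (x - a)) a,
    ← integral_add_right_eq_self (fun x => φ x • g (x - a)) a]
  simpa using this

theorem MemH1.comp_sub_right {u : Space → ℂ} (hu : MemH1 u) (a : Space) :
    MemH1 fun x => u (x - a) :=
  ⟨hu.1.comp_measurePreserving (measurePreserving_sub_right volume a),
    fun i => ⟨_, (hu.hasWeakPartial i).comp_sub_right a⟩⟩

theorem MemX.comp_sub_right {u : Space → ℂ} (hu : MemX u) {a : Space} (h0 : a 0 = 0)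
    (h1 : a 1 = 0) : MemX fun x => u (x - a) := by
  refine ⟨hu.1.comp_sub_right a, ?_⟩
  simpa [h0, h1] using hu.2.comp_sub_right a

/-- Translation invariance of Lebesgue measure applies to the Bochner integral including its default
value $0$, so this and the next identities need no integrability. -/
theorem mass_comp_sub_right (u : Space → ℂ) (a : Space) :
    mass (fun x => u (x - a)) = mass u :=
  integral_sub_right_eq_self (fun x => ‖u x‖ ^ 2) a

theorem powerInt_comp_sub_right (q : ℝ) (u : Space → ℂ) (a : Space) :
    powerInt q (fun x => u (x - a)) = powerInt q u :=
  integral_sub_right_eq_self (fun x => ‖u x‖ ^ q) a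

theorem confinement_comp_sub_right (u : Space → ℂ) {a : Space} (h0 : a 0 = 0) (h1 : a 1 = 0) :
    confinement (fun x => u (x - a)) = confinement u := by
  simpa [h0, h1, confinement] using
    integral_sub_right_eq_self (μ := volume)
      (fun x : Space => (x 0 ^ 2 + x 1 ^ 2) * ‖u x‖ ^ 2) a

theorem hartree_comp_sub_right (u : Space → ℂ) (a : Space) :
    hartree (fun x => u (x - a)) = hartree u := by
  unfold hartree
  rw [← integral_sub_right_eq_self
    (fun x : Space => (∫ y, ‖x - y‖⁻¹ * ‖u y‖ ^ 2) * ‖u x‖ ^ 2) a]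
  congr 1
  ext x
  rw [← integral_sub_right_eq_self (fun y : Space => ‖x - a - y‖⁻¹ * ‖u y‖ ^ 2) a]
  simp

/-- `weakPartial` is a chosen representative, so it commutes with translations only almost
everywhere, by uniqueness of weak derivatives. -/
theorem gradSq_comp_sub_right {u : Space → ℂ} (hu : MemH1 u) (a : Space) :
    gradSq (fun x => u (x - a)) = gradSq u := by
  unfold gradSq
  rw [← integral_sub_right_eq_self (fun x => ∑ i, ‖weakPartial i u x‖ ^ 2) a]
  refine integral_congr_ae ?_
  filter_upwards [ae_all_iff.2 fun i => ((hu.comp_sub_right a).hasWeakPartial i).ae_eq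
    ((hu.hasWeakPartial i).comp_sub_right a)] with x hx
  simp [hx]

theorem coulomb_comp_sub_right (u : Space → ℂ) (a : Space) :
    coulomb (fun x => u (x - a)) = ∫ x, ‖u x‖ ^ 2 / ‖x + a‖ := by
  unfold coulomb
  rw [← integral_add_right_eq_self _ a]
  simp

/-! ### Mollification in $L^2$ -/

/-- **Young's inequality** for the convolution with a probability density. -/
theorem lintegral_lintegral_mul_sub_sq_le {k F : Space → ℝ≥0∞} (hk : Measurable k)
    (hk1 : ∫⁻ t, k t = 1) (hF : Measurable F) :
    ∫⁻ x, (∫⁻ t, k t * F (x - t)) ^ 2 ≤ ∫⁻ x, F x ^ 2 := by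
  -- Jensen's inequality for the probability density $k$, obtained from Cauchy–Schwarz with the
  -- splitting $kF=k^{1/2}\cdot k^{1/2}F$.
  have key : ∀ x, (∫⁻ t, k t * F (x - t)) ^ 2 ≤ ∫⁻ t, k t * F (x - t) ^ 2 := by
    intro x
    have hsq : ∀ t, k t ^ (1 / 2 : ℝ) * k t ^ (1 / 2 : ℝ) = k t := fun t => by
      rw [← ENNReal.rpow_add_of_nonneg _ _ (by norm_num) (by norm_num)]; norm_num
    have hs2 : ∀ t, (k t ^ (1 / 2 : ℝ)) ^ (2 : ℝ) = k t := fun t => by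
      rw [← ENNReal.rpow_mul]; norm_num
    have hm : Measurable fun t => k t ^ (1 / 2 : ℝ) * F (x - t) :=
      (hk.pow_const _).mul (hF.comp (measurable_const.sub measurable_id))
    have := ENNReal.lintegral_mul_le_Lp_mul_Lq volume
      (p := 2) (q := 2) Real.HolderConjugate.two_two
      (f := fun t => k t ^ (1 / 2 : ℝ)) (g := fun t => k t ^ (1 / 2 : ℝ) * F (x - t))
      (hk.pow_const _).aemeasurable hm.aemeasurable
    simp only [Pi.mul_apply, ← mul_assoc, hsq, hs2, hk1, ENNReal.one_rpow, one_mul,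
      ENNReal.mul_rpow_of_nonneg _ _ (zero_le_two : (0 : ℝ) ≤ 2), ENNReal.rpow_two] at this
    calc (∫⁻ t, k t * F (x - t)) ^ 2
        ≤ ((∫⁻ t, k t * F (x - t) ^ 2) ^ (1 / 2 : ℝ)) ^ 2 := by gcongr
      _ = ∫⁻ t, k t * F (x - t) ^ 2 := by
        rw [← ENNReal.rpow_two, ← ENNReal.rpow_mul]; norm_num
  calc ∫⁻ x, (∫⁻ t, k t * F (x - t)) ^ 2
      ≤ ∫⁻ x, ∫⁻ t, k t * F (x - t) ^ 2 := lintegral_mono key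
    _ = ∫⁻ t, ∫⁻ x, k t * F (x - t) ^ 2 := by
      refine lintegral_lintegral_swap (Measurable.aemeasurable ?_)
      exact (hk.comp measurable_snd).mul
        ((hF.comp (measurable_fst.sub measurable_snd)).pow_const 2)
    _ = ∫⁻ t, k t * ∫⁻ x, F x ^ 2 := by
      congr 1; ext t
      have hm : Measurable fun x => F (x - t) ^ 2 :=
        (hF.comp (measurable_id.sub measurable_const)).pow_const 2
      rw [lintegral_const_mul _ hm, lintegral_sub_right_eq_self (fun x => F x ^ 2) t]
    _ = ∫⁻ x, F x ^ 2 := by rw [lintegral_mul_const _ hk, hk1, one_mul]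

theorem eLpNorm_two_eq (f : Space → ℂ) :
    eLpNorm f 2 volume = (∫⁻ x, ‖f x‖ₑ ^ 2) ^ (1 / 2 : ℝ) := by
  rw [eLpNorm_eq_lintegral_rpow_enorm_toReal (by norm_num) (by norm_num)]
  simp

theorem eLpNorm_normed_convolution_le (φ : ContDiffBump (0 : Space)) {g : Space → ℂ}
    (hg : AEStronglyMeasurable g volume) :
    eLpNorm (φ.normed volume ⋆[ContinuousLinearMap.lsmul ℝ ℝ, volume] g) 2 volume ≤
      eLpNorm g 2 volume := by
  obtain ⟨g', hg', hgg'⟩ := hg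
  have hconv : (φ.normed volume ⋆[ContinuousLinearMap.lsmul ℝ ℝ, volume] g) =
      φ.normed volume ⋆[ContinuousLinearMap.lsmul ℝ ℝ, volume] g' :=
    convolution_congr _ (ae_eq_refl _) hgg'
  rw [hconv, eLpNorm_congr_ae hgg', eLpNorm_two_eq, eLpNorm_two_eq]
  gcongr ?_ ^ _
  have hcont : Continuous (φ.normed (volume : Measure Space)) := φ.continuous_normed
  refine le_trans ?_ (lintegral_lintegral_mul_sub_sq_le
    (k := fun t => ‖φ.normed volume t‖ₑ) hcont.measurable.enorm ?_ hg'.measurable.enorm)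
  · gcongr with x
    rw [convolution_def]
    refine (enorm_integral_le_lintegral_enorm _).trans_eq ?_
    simp only [ContinuousLinearMap.lsmul_apply, enorm_smul]
  · rw [← ofReal_integral_norm_eq_lintegral_enorm φ.integrable_normed]
    simp_rw [Real.norm_of_nonneg (φ.nonneg_normed _)]
    simp [φ.integral_normed]

/-- The derivative falls on the smooth kernel. Testing the weak derivative against
$y\mapsto\varphi(x-y)$ moves it to $u$; the sign from the reflection cancels the one from
integration by parts. -/
theorem fderiv_normed_convolution (φ : ContDiffBump (0 : Space)) {i : Fin 3} {u g : Space → ℂ}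
    (hu : LocallyIntegrable u volume) (h : HasWeakPartial i u g) (x : Space) :
    fderiv ℝ (φ.normed volume ⋆[ContinuousLinearMap.lsmul ℝ ℝ, volume] u) x
        (EuclideanSpace.single i 1) =
      (φ.normed volume ⋆[ContinuousLinearMap.lsmul ℝ ℝ, volume] g) x := by
  have hφc : HasCompactSupport (φ.normed (volume : Measure Space)) := φ.hasCompactSupport_normed
  have hφd : ContDiff ℝ ∞ (φ.normed (volume : Measure Space)) := φ.contDiff_normed
  have hd := hφc.hasFDerivAt_convolution_left (ContinuousLinearMap.lsmul ℝ ℝ)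
    (μ := (volume : Measure Space)) (hφd.of_le (by exact_mod_cast le_top)) hu x
  rw [hd.fderiv, convolution_eq_swap, convolution_eq_swap,
    ContinuousLinearMap.integral_apply]
  · have hψ : IsTest fun y => φ.normed volume (x - y) :=
      ⟨hφd.comp (contDiff_const.sub contDiff_id),
        hφc.comp_homeomorph (Homeomorph.subLeft x)⟩
    have hp : ∀ y, pderiv i (fun y => φ.normed volume (x - y)) y =
        -fderiv ℝ (φ.normed volume) (x - y) (EuclideanSpace.single i 1) := fun y => by
      have h1 := ((hφd.differentiable (by simp) (x - y)).hasFDerivAt.comp y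
        ((hasFDerivAt_id y).const_sub x)).fderiv
      change fderiv ℝ (fun y => φ.normed volume (x - y)) y = _ at h1
      rw [pderiv, h1]; simp
    have := h.2 _ hψ
    simp only [hp, neg_smul, integral_neg, neg_inj] at this
    simpa [ContinuousLinearMap.precompL_apply] using this
  · have := (hφc.fderiv ℝ).convolutionExists_left
      ((ContinuousLinearMap.lsmul ℝ ℝ : ℝ →L[ℝ] ℂ →L[ℝ] ℂ).precompL Space)
      (hφd.continuous_fderiv (by simp)) hu x
    exact this.integrable_swap

/-! ### The Sobolev embedding -/

theorem norm_le_sum_norm_apply_single (T : Space →L[ℝ] ℂ) :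
    ‖T‖ ≤ ∑ i, ‖T (EuclideanSpace.single i 1)‖ := by
  refine T.opNorm_le_bound (by positivity) fun x => ?_
  have hx : x = ∑ i, x i • EuclideanSpace.single i (1 : ℝ) := by
    ext j; simp [Finset.sum_apply, Pi.single_apply]
  conv_lhs => rw [hx]
  rw [map_sum, Finset.sum_mul]
  refine (norm_sum_le _ _).trans (Finset.sum_le_sum fun i _ => ?_)
  rw [map_smul, norm_smul, mul_comm]
  gcongr
  exact PiLp.norm_apply_le x i

/-- Fatou's lemma: it removes first the cutoff, then the mollification, from the Sobolev inequality.
-/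
theorem eLpNorm_le_of_ae_tendsto {q B : ℝ≥0∞} {f : ℕ → Space → ℂ} {g : Space → ℂ}
    (hf : ∀ n, Continuous (f n)) (hlim : ∀ᵐ x, Tendsto (fun n => f n x) atTop (𝓝 (g x)))
    (hB : ∀ n, eLpNorm (f n) q volume ≤ B) : eLpNorm g q volume ≤ B :=
  (Lp.eLpNorm_lim_le_liminf_eLpNorm (fun n => (hf n).aestronglyMeasurable) g hlim).trans
    (liminf_le_of_frequently_le' (Frequently.of_forall hB))

/-- The gradient of `v` times a cutoff function at scale `n + 1` is controlled uniformly in `n`. -/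
theorem norm_fderiv_cutoff_smul_le (χ : ContDiffBump (0 : Space)) {K : ℝ}
    (hK : ∀ x, ‖fderiv ℝ χ x‖ ≤ K) {v : Space → ℂ} (hv : ContDiff ℝ 1 v) (n : ℕ) (x : Space) :
    ‖fderiv ℝ (fun x => χ ((n + 1 : ℝ)⁻¹ • x) • v x) x‖ ≤ ‖fderiv ℝ v x‖ + K * ‖v x‖ := by
  have hχd : ContDiff ℝ 1 χ := χ.contDiff
  have h1 : HasFDerivAt (fun x : Space => χ ((n + 1 : ℝ)⁻¹ • x))
      ((fderiv ℝ χ ((n + 1 : ℝ)⁻¹ • x)).comp ((n + 1 : ℝ)⁻¹ • ContinuousLinearMap.id ℝ Space))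
      x :=
    (hχd.differentiable one_ne_zero _).hasFDerivAt.comp x
      ((n + 1 : ℝ)⁻¹ • ContinuousLinearMap.id ℝ Space).hasFDerivAt
  have h2 := (h1.smul (hv.differentiable one_ne_zero x).hasFDerivAt).fderiv
  change fderiv ℝ (fun x => χ ((n + 1 : ℝ)⁻¹ • x) • v x) x = _ at h2
  rw [h2]
  refine (norm_add_le _ _).trans ?_
  gcongr
  · rw [norm_smul, Real.norm_of_nonneg χ.nonneg]
    exact mul_le_of_le_one_left (norm_nonneg _) χ.le_one
  · refine (ContinuousLinearMap.norm_smulRight_apply _ _).trans_le ?_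
    gcongr
    rw [ContinuousLinearMap.comp_smul, norm_smul, ContinuousLinearMap.comp_id]
    refine (mul_le_of_le_one_left (norm_nonneg _) ?_).trans (hK _)
    rw [Real.norm_of_nonneg (by positivity)]
    exact inv_le_one_of_one_le₀ (by linarith [(Nat.cast_nonneg n : (0 : ℝ) ≤ n)])

/-- The **Gagliardo–Nirenberg–Sobolev inequality** in dimension three. -/
theorem exists_eLpNorm_six_le_of_hasCompactSupport :
    ∃ S : ℝ≥0, ∀ w : Space → ℂ, ContDiff ℝ 1 w → HasCompactSupport w →
      eLpNorm w 6 volume ≤ S * eLpNorm (fderiv ℝ w) 2 volume := by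
  refine ⟨SNormLESNormFDerivOfEqConst ℂ (volume : Measure Space) ((2 : ℝ≥0) : ℝ),
    fun w hw hcs => ?_⟩
  have h6 : (((6 : ℝ≥0) : ℝ))⁻¹ =
      ((2 : ℝ≥0) : ℝ)⁻¹ - (Module.finrank ℝ Space : ℝ)⁻¹ := by
    rw [finrank_euclideanSpace_fin]; norm_num
  have h := eLpNorm_le_eLpNorm_fderiv_of_eq (volume : Measure Space) hw hcs
    (p := 2) (p' := 6) one_le_two (by rw [finrank_euclideanSpace_fin]; norm_num) h6
  have e6 : ((6 : ℝ≥0) : ℝ≥0∞) = 6 := by norm_num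
  have e2 : ((2 : ℝ≥0) : ℝ≥0∞) = 2 := by norm_num
  rwa [e6, e2] at h

/-- The **Sobolev inequality** for `C¹` functions without condition on the support. -/
theorem exists_eLpNorm_six_le :
    ∃ C : ℝ≥0, ∀ v : Space → ℂ, ContDiff ℝ 1 v →
      eLpNorm v 6 volume ≤ C * (eLpNorm (fderiv ℝ v) 2 volume + C * eLpNorm v 2 volume) := by
  let χ : ContDiffBump (0 : Space) := ⟨1, 2, one_pos, one_lt_two⟩
  have hχd : ContDiff ℝ 1 χ := χ.contDiff
  obtain ⟨K, hK⟩ := (hχd.continuous_fderiv one_ne_zero).bounded_above_of_compact_support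
    (χ.hasCompactSupport.fderiv ℝ)
  obtain ⟨S, hS⟩ := exists_eLpNorm_six_le_of_hasCompactSupport
  -- One constant dominates both the Sobolev constant $S$ and the bound $K$ on the gradient of the
  -- cutoff.
  refine ⟨max S K.toNNReal, fun v hv => ?_⟩
  let w : ℕ → Space → ℂ := fun n x => χ ((n + 1 : ℝ)⁻¹ • x) • v x
  have hχn : ∀ n : ℕ, ContDiff ℝ 1 fun x : Space => χ ((n + 1 : ℝ)⁻¹ • x) := fun n =>
    hχd.comp (contDiff_const_smul _)
  have hw : ∀ n, ContDiff ℝ 1 (w n) := fun n => (hχn n).smul hv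
  have hχcs : ∀ n : ℕ, HasCompactSupport fun x : Space => χ ((n + 1 : ℝ)⁻¹ • x) := fun n =>
    χ.hasCompactSupport.comp_homeomorph
      (Homeomorph.smulOfNeZero ((n + 1 : ℝ)⁻¹) (by positivity))
  have hcs : ∀ n, HasCompactSupport (w n) := fun n =>
    HasCompactSupport.smul_right (f := fun x : Space => χ ((n + 1 : ℝ)⁻¹ • x)) (f' := v) (hχcs n)
  have hfd : ∀ n x, ‖fderiv ℝ (w n) x‖ ≤ ‖fderiv ℝ v x‖ + K * ‖v x‖ :=
    norm_fderiv_cutoff_smul_le χ hK hv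
  have hK0 : 0 ≤ K := (norm_nonneg _).trans (hK 0)
  have hbound : ∀ n, eLpNorm (w n) 6 volume ≤
      S * (eLpNorm (fderiv ℝ v) 2 volume + K.toNNReal * eLpNorm v 2 volume) := by
    intro n
    refine (hS _ (hw n) (hcs n)).trans ?_
    gcongr
    calc eLpNorm (fderiv ℝ (w n)) 2 volume
        ≤ eLpNorm (fun x => ‖fderiv ℝ v x‖ + K * ‖v x‖) 2 volume :=
          eLpNorm_mono_real (hfd n)
      _ ≤ eLpNorm (fun x => ‖fderiv ℝ v x‖) 2 volume + eLpNorm (fun x => K * ‖v x‖) 2 volume :=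
          eLpNorm_add_le (hv.continuous_fderiv one_ne_zero).norm.aestronglyMeasurable
            (hv.continuous.norm.const_smul K).aestronglyMeasurable (by norm_num)
      _ = _ := by
        rw [eLpNorm_norm]
        congr 1
        rw [show (fun x => K * ‖v x‖) = K • fun x => ‖v x‖ from rfl, eLpNorm_const_smul,
          eLpNorm_norm, Real.enorm_of_nonneg hK0]
        rfl
  have hlim : ∀ x, Tendsto (fun n => w n x) atTop (𝓝 (v x)) := by
    intro x
    have h0 : Tendsto (fun n : ℕ => ((n : ℝ) + 1)⁻¹ • x) atTop (𝓝 ((0 : ℝ) • x)) := by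
      refine Tendsto.smul_const ?_ x
      simpa using tendsto_one_div_add_atTop_nhds_zero_nat (𝕜 := ℝ)
    have h1 := ((hχd.continuous.tendsto _).comp h0).smul_const (v x)
    have h2 : χ ((0 : ℝ) • x) = 1 := by
      rw [zero_smul]; exact χ.one_of_mem_closedBall (by simp [χ])
    rw [h2, one_smul] at h1
    exact h1
  refine (eLpNorm_le_of_ae_tendsto (fun n => (hw n).continuous)
    (Eventually.of_forall hlim) hbound).trans ?_
  gcongr
  · exact le_max_left _ _
  · exact le_max_right _ _

/-- The **Sobolev embedding** of `H¹` into `L⁶`. -/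
theorem MemH1.memLp_six {u : Space → ℂ} (hu : MemH1 u) : MemLp u 6 volume := by
  refine ⟨hu.1.1, ?_⟩
  obtain ⟨C, hC⟩ := exists_eLpNorm_six_le
  have hloc : LocallyIntegrable u volume := hu.1.locallyIntegrable (by norm_num)
  -- The ratio of outer to inner radius stays equal to $2$, as required for almost everywhere
  -- convergence of the mollifications of a locally integrable function.
  let φ : ℕ → ContDiffBump (0 : Space) := fun n =>
    ⟨((n : ℝ) + 1)⁻¹, 2 * ((n : ℝ) + 1)⁻¹, by positivity, by
      have : 0 < ((n : ℝ) + 1)⁻¹ := by positivity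
      linarith⟩
  let v : ℕ → Space → ℂ := fun n =>
    (φ n).normed volume ⋆[ContinuousLinearMap.lsmul ℝ ℝ, volume] u
  have hv : ∀ n, ContDiff ℝ 1 (v n) := fun n =>
    ((φ n).hasCompactSupport_normed).contDiff_convolution_left (n := 1) _
      ((φ n).contDiff_normed) hloc
  have hlim : ∀ᵐ x, Tendsto (fun n => v n x) atTop (𝓝 (u x)) := by
    refine ContDiffBump.ae_convolution_tendsto_right_of_locallyIntegrable (K := 2) ?_
      (Eventually.of_forall fun n => le_rfl) hloc
    simpa using (tendsto_one_div_add_atTop_nhds_zero_nat (𝕜 := ℝ)).const_mul 2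
  have hbound : ∀ n, eLpNorm (v n) 6 volume ≤
      C * (∑ i, eLpNorm (weakPartial i u) 2 volume + C * eLpNorm u 2 volume) := by
    intro n
    refine (hC _ (hv n)).trans ?_
    gcongr
    · calc eLpNorm (fderiv ℝ (v n)) 2 volume
          ≤ eLpNorm (fun x => ∑ i, ‖fderiv ℝ (v n) x (EuclideanSpace.single i 1)‖) 2 volume :=
            eLpNorm_mono_real fun x => norm_le_sum_norm_apply_single _
        _ ≤ ∑ i, eLpNorm (fun x => ‖fderiv ℝ (v n) x (EuclideanSpace.single i 1)‖) 2 volume := by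
            have := eLpNorm_sum_le (μ := (volume : Measure Space)) (p := 2) (s := Finset.univ)
              (f := fun i x => ‖fderiv ℝ (v n) x (EuclideanSpace.single i 1)‖)
              (fun i _ => (((hv n).continuous_fderiv one_ne_zero).clm_apply
                continuous_const).norm.aestronglyMeasurable) (by norm_num)
            convert this using 2
            ext x; simp
        _ ≤ _ := by
            gcongr with i
            rw [eLpNorm_norm]
            simp_rw [v, fderiv_normed_convolution (φ n) hloc (hu.hasWeakPartial i)]
            exact eLpNorm_normed_convolution_le _ (hu.hasWeakPartial i).1.1
    · exact eLpNorm_normed_convolution_le _ hu.1.1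
  refine (eLpNorm_le_of_ae_tendsto (fun n => (hv n).continuous) hlim hbound).trans_lt ?_
  exact ENNReal.mul_lt_top ENNReal.coe_lt_top (ENNReal.add_lt_top.2
    ⟨ENNReal.sum_lt_top.2 fun i _ => (hu.hasWeakPartial i).1.2,
      ENNReal.mul_lt_top ENNReal.coe_lt_top hu.1.2⟩)

/-! ### The Coulomb term -/

theorem integrable_indicator_ball_inv_norm_sq :
    Integrable ((Metric.ball (0 : Space) 1).indicator fun x => (‖x‖ ^ 2)⁻¹) volume := by
  refine (integrable_indicator_iff Metric.isOpen_ball.measurableSet).2 ?_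
  refine integrableOn_ball_of_norm_le_rpow (C := 1) (α := 2) (by simp) (by simp; norm_num)
    (Eventually.of_forall fun x => ?_)
    (measurable_norm.pow_const 2).inv.aestronglyMeasurable
  rw [Real.norm_of_nonneg (by positivity), one_mul, Real.rpow_neg (norm_nonneg _), Real.rpow_two]

/-- The Coulomb potential with the part near the singularity replaced by the constant `δ⁻¹`. -/
noncomputable def truncatedCoulomb (δ : ℝ) (z : Space) : ℝ := if ‖z‖ < 1 then δ⁻¹ else ‖z‖⁻¹

theorem measurable_truncatedCoulomb (δ : ℝ) : Measurable (truncatedCoulomb δ) :=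
  Measurable.ite (measurableSet_lt measurable_norm measurable_const) measurable_const
    measurable_norm.inv

theorem truncatedCoulomb_nonneg {δ : ℝ} (hδ : 0 < δ) (z : Space) : 0 ≤ truncatedCoulomb δ z := by
  unfold truncatedCoulomb; split_ifs <;> positivity

theorem truncatedCoulomb_le {δ : ℝ} (hδ : 0 < δ) (z : Space) :
    truncatedCoulomb δ z ≤ δ⁻¹ + 1 := by
  have : 0 < δ⁻¹ := by positivity
  unfold truncatedCoulomb
  split_ifs with h
  · linarith
  · linarith [inv_le_one_of_one_le₀ (not_lt.1 h)]

theorem tendsto_truncatedCoulomb (δ : ℝ) {l : Filter ℕ} {z : ℕ → Space}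
    (hz : Tendsto (fun n => ‖z n‖) l atTop) :
    Tendsto (fun n => truncatedCoulomb δ (z n)) l (𝓝 0) := by
  refine (tendsto_inv_atTop_zero.comp hz).congr' ?_
  filter_upwards [hz.eventually_ge_atTop 1] with n hn
  simp [truncatedCoulomb, not_lt.2 hn]

/-- Near the origin, a weighted Young inequality splits $t^2/|z|$ into $t^4/\delta$ and
$\delta/|z|^2$. The singular part no longer involves $t$ and has a small coefficient; the other part
carries a bounded kernel that vanishes at infinity. -/
theorem sq_div_norm_le {δ : ℝ} (hδ : 0 < δ) {t : ℝ} (z : Space) :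
    t ^ 2 / ‖z‖ ≤ (t ^ 2 + t ^ 6) * truncatedCoulomb δ z +
      δ * (Metric.ball (0 : Space) 1).indicator (fun x => (‖x‖ ^ 2)⁻¹) z := by
  unfold truncatedCoulomb
  split_ifs with h
  · rw [Set.indicator_of_mem (by simpa using h), ← inv_pow, div_eq_mul_inv]
    set k := ‖z‖⁻¹
    -- This follows from $t^2(t^2-1)^2\ge0$; it trades $t^4$ for the powers given by $L^2$ and
    -- $L^6$.
    have h4 : t ^ 4 ≤ t ^ 2 + t ^ 6 := by
      nlinarith [mul_nonneg (sq_nonneg t) (sq_nonneg (t ^ 2 - 1)), sq_nonneg t,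
        pow_nonneg (sq_nonneg t) 3]
    have h1 : t ^ 2 * k ≤ t ^ 4 * δ⁻¹ + δ * k ^ 2 := by
      have e : t ^ 4 * δ⁻¹ + δ * k ^ 2 - t ^ 2 * k =
          δ⁻¹ * ((t ^ 2 - δ * k / 2) ^ 2 + 3 / 4 * (δ * k) ^ 2) := by
        field_simp; ring
      have : 0 ≤ δ⁻¹ * ((t ^ 2 - δ * k / 2) ^ 2 + 3 / 4 * (δ * k) ^ 2) := by positivity
      linarith
    have h2 : t ^ 4 * δ⁻¹ ≤ (t ^ 2 + t ^ 6) * δ⁻¹ := by gcongr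
    linarith
  · rw [Set.indicator_of_notMem (by simpa using h), mul_zero, add_zero, div_eq_mul_inv]
    have : 0 ≤ t ^ 6 := by positivity
    gcongr
    linarith

theorem MemH1.integrable_sq_add_pow_six {u : Space → ℂ} (hu : MemH1 u) :
    Integrable (fun x => ‖u x‖ ^ 2 + ‖u x‖ ^ 6) volume :=
  (hu.1.integrable_norm_pow (p := 2) (by norm_num)).add
    (hu.memLp_six.integrable_norm_pow (p := 6) (by norm_num))

theorem MemH1.integrable_mul_truncatedCoulomb {u : Space → ℂ} (hu : MemH1 u) {δ : ℝ} (hδ : 0 < δ)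
    (a : Space) :
    Integrable (fun x => (‖u x‖ ^ 2 + ‖u x‖ ^ 6) * truncatedCoulomb δ (x + a)) volume := by
  refine hu.integrable_sq_add_pow_six.mul_bdd (c := δ⁻¹ + 1)
    ((measurable_truncatedCoulomb δ).comp
      (measurable_id.add measurable_const)).aestronglyMeasurable
    (Eventually.of_forall fun x => ?_)
  rw [Real.norm_of_nonneg (truncatedCoulomb_nonneg hδ _)]
  exact truncatedCoulomb_le hδ _

theorem MemH1.integrable_sq_div_norm_add {u : Space → ℂ} (hu : MemH1 u) (a : Space) :
    Integrable (fun x => ‖u x‖ ^ 2 / ‖x + a‖) volume := by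
  refine ((hu.integrable_mul_truncatedCoulomb one_pos a).add
    ((integrable_indicator_ball_inv_norm_sq.comp_add_right a).const_mul 1)).mono'
    ((hu.1.1.norm.pow 2).aemeasurable.div
      (measurable_norm.comp (measurable_id.add measurable_const)).aemeasurable).aestronglyMeasurable
    (Eventually.of_forall fun x => ?_)
  rw [Real.norm_of_nonneg (by positivity)]
  exact sq_div_norm_le one_pos (x + a)

/-- The singular part contributes $\delta I$ for every translation, by invariance of its integral.
For fixed $\delta$ the rest tends to $0$ by dominated convergence, and $\delta$ is arbitrary. -/
theorem MemH1.tendsto_coulomb_comp_sub_right {u : Space → ℂ} (hu : MemH1 u) {a : ℕ → Space}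
    (ha : Tendsto (fun n => ‖a n‖) atTop atTop) :
    Tendsto (fun n => coulomb fun x => u (x - a n)) atTop (𝓝 0) := by
  simp only [coulomb_comp_sub_right]
  set ψ : Space → ℝ := (Metric.ball (0 : Space) 1).indicator fun x => (‖x‖ ^ 2)⁻¹ with hψ
  have hψi : Integrable ψ volume := integrable_indicator_ball_inv_norm_sq
  set I := ∫ x, ψ x
  have hI : 0 ≤ I := integral_nonneg fun x =>
    Set.indicator_nonneg (fun y _ => by positivity) x
  have hbound : ∀ δ > 0, ∀ n, ∫ x, ‖u x‖ ^ 2 / ‖x + a n‖ ≤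
      (∫ x, (‖u x‖ ^ 2 + ‖u x‖ ^ 6) * truncatedCoulomb δ (x + a n)) + δ * I := by
    intro δ hδ n
    have hψn := (hψi.comp_add_right (a n)).const_mul δ
    have e : δ * I = ∫ x, δ * ψ (x + a n) := by
      rw [integral_const_mul, integral_add_right_eq_self]
    rw [e, ← integral_add (hu.integrable_mul_truncatedCoulomb hδ _) hψn]
    exact integral_mono (hu.integrable_sq_div_norm_add _)
      ((hu.integrable_mul_truncatedCoulomb hδ _).add hψn) fun x => sq_div_norm_le hδ _
  have hlim : ∀ δ > 0, Tendsto
      (fun n => ∫ x, (‖u x‖ ^ 2 + ‖u x‖ ^ 6) * truncatedCoulomb δ (x + a n)) atTop (𝓝 0) := by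
    intro δ hδ
    have := tendsto_integral_of_dominated_convergence
      (F := fun n x => (‖u x‖ ^ 2 + ‖u x‖ ^ 6) * truncatedCoulomb δ (x + a n))
      (f := fun _ => 0) (μ := (volume : Measure Space))
      (fun x => (‖u x‖ ^ 2 + ‖u x‖ ^ 6) * (δ⁻¹ + 1))
      (fun n => (hu.integrable_mul_truncatedCoulomb hδ _).1)
      (hu.integrable_sq_add_pow_six.mul_const _)
      (fun n => Eventually.of_forall fun x => by
        rw [Real.norm_of_nonneg (mul_nonneg (by positivity) (truncatedCoulomb_nonneg hδ _))]
        gcongr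
        exact truncatedCoulomb_le hδ _)
      (Eventually.of_forall fun x => by
        have hx : Tendsto (fun n => ‖x + a n‖) atTop atTop := by
          refine tendsto_atTop_mono (fun n => ?_) (tendsto_atTop_add_const_right _ (-‖x‖) ha)
          have := norm_sub_le (x + a n) x
          rw [add_sub_cancel_left] at this
          linarith
        simpa using (tendsto_truncatedCoulomb δ hx).const_mul (‖u x‖ ^ 2 + ‖u x‖ ^ 6))
    simpa using this
  rw [Metric.tendsto_atTop']
  intro ε hε
  -- This $\delta$ gives $\delta I\le\varepsilon/2$; the $+1$ avoids having to know $I\ne0$.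
  have hδ : 0 < ε / (2 * (I + 1)) := by positivity
  have hδI : ε / (2 * (I + 1)) * I ≤ ε / 2 := by
    rw [div_mul_eq_mul_div, div_le_div_iff₀ (by positivity) two_pos]
    nlinarith
  obtain ⟨N, hN⟩ := (Metric.tendsto_atTop'.1 (hlim _ hδ)) (ε / 2) (by positivity)
  refine ⟨N, fun n hn => ?_⟩
  have h1 := hN n hn
  rw [Real.dist_0_eq_abs] at h1 ⊢
  rw [abs_of_nonneg (integral_nonneg fun x => by positivity)]
  linarith [hbound _ hδ n, le_abs_self
    (∫ x, (‖u x‖ ^ 2 + ‖u x‖ ^ 6) * truncatedCoulomb (ε / (2 * (I + 1))) (x + a n))]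

/-- A nonnegative integrable function with integral $0$ vanishes almost everywhere. Integrability
matters: without it the Bochner integral would be $0$ by default. -/
theorem MemH1.coulomb_pos {u : Space → ℂ} (hu : MemH1 u) (h : 0 < mass u) : 0 < coulomb u := by
  have hint : Integrable (fun x => ‖u x‖ ^ 2 / ‖x‖) volume := by
    simpa using hu.integrable_sq_div_norm_add 0
  have h0 : 0 ≤ fun x => ‖u x‖ ^ 2 / ‖x‖ := fun x => by positivity
  refine (integral_nonneg h0).lt_of_ne' fun hz => h.ne' ?_
  refine integral_eq_zero_of_ae ?_
  filter_upwards [(integral_eq_zero_iff_of_nonneg h0 hint).1 hz,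
    compl_mem_ae_iff.2 (measure_singleton (0 : Space))] with x hx hx0
  have : ‖x‖ ≠ 0 := by simpa using hx0
  simpa [this] using hx

/-! ### Nonexistence of minimizers -/

theorem minimizers_eq_empty (b l2 l3 p : ℝ) {l1 c : ℝ} (hl1 : 0 < l1) (hc : 0 < c) :
    minimizers b l1 l2 l3 p c = ∅ := by
  refine Set.eq_empty_of_forall_notMem fun u ⟨⟨huX, hum⟩, hmin⟩ => ?_
  -- Index $2$ is the $x_3$-direction, the one the confinement does not see.
  let a : ℕ → Space := fun n => EuclideanSpace.single 2 (n : ℝ)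
  have ha0 : ∀ n, a n 0 = 0 := fun n => by simp [a]
  have ha1 : ∀ n, a n 1 = 0 := fun n => by simp [a]
  have ha : Tendsto (fun n => ‖a n‖) atTop atTop := by
    simpa [a] using tendsto_natCast_atTop_atTop (R := ℝ)
  obtain ⟨n, hn⟩ := ((huX.1.tendsto_coulomb_comp_sub_right ha).eventually_lt_const
    (huX.1.coulomb_pos (hum ▸ hc))).exists
  have hmem : (fun x => u (x - a n)) ∈ sphere c :=
    ⟨huX.comp_sub_right (ha0 n) (ha1 n), (mass_comp_sub_right u (a n)).trans hum⟩
  -- Only the lower-bound property of the infimum is used, so $m(c)=-\infty$ needs no separate case.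
  have hle : energy b l1 l2 l3 p u ≤ energy b l1 l2 l3 p fun x => u (x - a n) := by
    rw [← EReal.coe_le_coe_iff, hmin]
    exact iInf₂_le _ hmem
  simp only [energy, gradSq_comp_sub_right huX.1, confinement_comp_sub_right u (ha0 n) (ha1 n),
    hartree_comp_sub_right, powerInt_comp_sub_right] at hle
  -- All other terms cancel, leaving a comparison of the two Coulomb terms that contradicts `hn`
  -- because $\lambda_1>0$.
  nlinarith

end XFEL

theorem theorem5p1 (b l1 l2 l3 : ℝ) (hl1 : 0 < l1) (hl2 : l2 ≤ 0) (hl3 : 0 < l3) :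
    (∀ p c : ℝ, 0 < p → p < 4 / 3 → 0 < c → XFEL.minimizers b l1 l2 l3 p c = ∅) ∧
    (∀ (R : XFEL.Space → ℂ) (c : ℝ), XFEL.IsGroundState R → 0 < c →
      c < l3 ^ (-(3 / 2) : ℝ) * XFEL.mass R →
        XFEL.minimizers b l1 l2 l3 (4 / 3) c = ∅) :=
  ⟨fun p _ _ _ hc => XFEL.minimizers_eq_empty b l2 l3 p hl1 hc,
    fun _ _ _ hc _ => XFEL.minimizers_eq_empty b l2 l3 (4 / 3) hl1 hc⟩
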